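/- Let $G$ be a finite simple bipartite graph (properly 2-coloured) drawn in the plane without crossings, with an edge weight $\omega_e$ from a commutative ring on every edge $e$. For a weighted graph $H$ let $M(H)$ be the sum, over all perfect matchings $P$ of $H$, of $\prod_{e\in P}\omega_e$; subgraphs of $G$ inherit its weights, and $G-e$, $G-x$ denote deletion of an edge $e$, respectively of a vertex $x$ with all its incident edges. Let $e_1=a_1b_1$ and $e_2=a_2b_2$ be two independent edges (no common end) on the boundary of a face of $G$, and suppose that the vertices $a_1,b_1,a_2,b_2$ appear in this cyclic order on a face of $G$, that is, a closed topological disc can be inscribed in the face so that it touches $G$ exactly in these four vertices, and they occur in this cyclic order along the boundary of the disc. (In each case below $\omega_1=\omega_{e_1}$ and $\omega_2=\omega_{e_2}$.) (1) If $a_1$ and $a_2$ have the same colour, then $$M(G)\,M(G-e_1-e_2)=M(G-e_1)\,M(G-e_2)+\omega_1\omega_2\,M(G-a_1-b_2)\,M(G-a_2-b_1).$$ (2) If $a_1$ and $a_2$ have different colours, then $$M(G)\,M(G-e_1-e_2)=M(G-e_1)\,M(G-e_2)-\omega_1\omega_2\,M(G-a_1-a_2)\,M(G-b_1-b_2).$$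 -/

import Mathlib

/-- A plane drawing of the simple graph `G`, the plane being identified with `ℂ`: vertices are
distinct points, edges are (arbitrary continuous) simple arcs joining the two ends of the edge and
containing no other vertex, and two different edges have at most end vertices in common. -/
structure PlaneDrawing {V : Type*} (G : SimpleGraph V) where
  /-- the point representing a vertex -/
  pos : V → ℂ
  /-- the point set representing an edge (irrelevant on non-edges) -/
  arc : Sym2 V → Set ℂ
  pos_injective : Function.Injective pos
  arc_isArc : ∀ u v : V, G.Adj u v →
    ∃ γ : Path (pos u) (pos v), Function.Injective γ ∧ Set.range γ = arc s(u, v)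
  mem_of_pos_mem_arc : ∀ e ∈ G.edgeSet, ∀ v : V, pos v ∈ arc e → v ∈ e
  arc_inter_arc : ∀ e ∈ G.edgeSet, ∀ e' ∈ G.edgeSet, e ≠ e' → arc e ∩ arc e' ⊆ Set.range pos

namespace PlaneDrawing

variable {V : Type*} {G : SimpleGraph V}

/-- The set of all points of the plane that lie on the drawn graph. -/
def support (D : PlaneDrawing G) : Set ℂ :=
  Set.range D.pos ∪ ⋃ e ∈ G.edgeSet, D.arc e

/-- A face is a connected component of the complement of the drawn graph (the unbounded one
included). -/
def IsFace (D : PlaneDrawing G) (F : Set ℂ) : Prop :=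
  ∃ z ∈ D.supportᶜ, F = connectedComponentIn D.supportᶜ z

/-- The edge `e` lies on the boundary of the face `F`. -/
def EdgeOnBoundary (D : PlaneDrawing G) (F : Set ℂ) (e : Sym2 V) : Prop :=
  e ∈ G.edgeSet ∧ D.arc e ⊆ frontier F

/-- The vertices `p`, `q`, `r`, `s` appear in this cyclic order on the face `F`: a closed
topological disc can be inscribed in `F` so that it touches the drawn graph exactly at these four
vertices, which are met in the order `p`, `q`, `r`, `s` when one runs once along the boundary
circle of the disc. The disc is parametrized by the closed unit disc with the four vertices at
`1`, `i`, `-1`, `-i`; the parametrization may preserve or reverse the orientation. The boundary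
of `F` need not be a cycle, nor connected. -/
def CyclicOrderOnFace (D : PlaneDrawing G) (F : Set ℂ) (p q r s : V) : Prop :=
  D.IsFace F ∧
  ∃ φ : ℂ → ℂ,
    ContinuousOn φ (Metric.closedBall 0 1) ∧
    Set.InjOn φ (Metric.closedBall 0 1) ∧
    φ 1 = D.pos p ∧ φ Complex.I = D.pos q ∧ φ (-1) = D.pos r ∧ φ (-Complex.I) = D.pos s ∧
    ∀ z ∈ Metric.closedBall (0 : ℂ) 1,
      z ∉ ({1, Complex.I, -1, -Complex.I} : Set ℂ) → φ z ∈ F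

end PlaneDrawing

/-- `M(G)`: the sum over all perfect matchings `P` of the weighted graph `G` of the product of
the weights of the edges of `P`. -/
noncomputable def matchingSum {V R : Type*} [Finite V] [CommRing R]
    (G : SimpleGraph V) (w : Sym2 V → R) : R :=
  ∑ P ∈ (Set.toFinite {P : G.Subgraph | P.IsPerfectMatching}).toFinset,
    ∏ e ∈ (Set.toFinite P.edgeSet).toFinset, w e

/-- `M(G - A)` for a set `A` of vertices: the matching sum of the subgraph induced on the
complement of `A`, with the inherited weights. -/
noncomputable def matchingSumDelete {V R : Type*} [Finite V] [CommRing R]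
    (G : SimpleGraph V) (w : Sym2 V → R) (A : Set V) : R :=
  matchingSum (G.induce Aᶜ) (fun e => w (e.map Subtype.val))

/-! Write `p, q, r, s` for `a₁, b₁, a₂, b₂`, let `G'` be `G` without both edges, and let `m_S` be
the matching sum of `G' - S`. Splitting matchings by whether they use `e₁` and `e₂` gives M(G) = m_∅
+ ω₁ m_pq + ω₂ m_rs + ω₁ω₂ m_pqrs, M(G-e₁) = m_∅ + ω₂ m_rs and M(G-e₂) = m_∅ + ω₁ m_pq. Hence M(G)
M(G-e₁-e₂) - M(G-e₁) M(G-e₂) = ω₁ω₂ (m_∅ m_pqrs - m_pq m_rs).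

Condensation (`matchingSumOff_condensation`) turns the bracket into m_ps m_qr - m_pr m_qs, and the
colouring kills one of these products: a perfect matching fixes the colour imbalance of the deleted
set (`matchingSumOff_mul_eq_zero`).

Condensation is proved by superposing two matchings and exchanging them along the component of `p`.
This component contains exactly one more of the four vertices, and planarity excludes `r`: otherwise
`q` and `s` would be joined in another component (`unionComponent_ends`).

The planarity input is `exists_eq_of_paths_outside_disc`: disjoint paths outside an embedded disc
cannot join the ends of two perpendicular diameters. No Jordan curve theorem is used. Differences of
points on the paths and on the diameters would be nonvanishing on squares, forcing a certain closed
curve to have winding number 0, while that curve is homotopic to an odd one. -/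

/-! ### Increments of continuous logarithms. -/

/-- The increment over `[0, 1]` of a continuous logarithm of `f`. -/
noncomputable def logIncrement (f : ℝ → ℂ) : ℂ :=
  open Classical in
  if h : ∃ g : ℝ → ℂ, Continuous g ∧ ∀ t, Complex.exp (g t) = f t then h.choose 1 - h.choose 0
  else 0

theorem exists_continuous_log {A : Type*} [TopologicalSpace A] [SimplyConnectedSpace A]
    [LocallyPathConnectedSpace A] {f : A → ℂ} (hf : Continuous f) (h0 : ∀ a, f a ≠ 0) :
    ∃ g : A → ℂ, Continuous g ∧ ∀ a, Complex.exp (g a) = f a := by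
  obtain ⟨a₀⟩ : Nonempty A := inferInstance
  obtain ⟨g, ⟨-, hg⟩, -⟩ := Complex.isCoveringMapOn_exp.existsUnique_continuousMap_lifts
    (f := ⟨f, hf⟩) (a₀ := a₀) (e₀ := Complex.log (f a₀)) (by simp [Complex.exp_log (h0 a₀)])
    (by intro a; simpa using h0 a)
  exact ⟨g, g.continuous, fun a => congrFun hg a⟩

/-- Two continuous logarithms differ by an integer multiple of 2πi at each point, and this integer
is constant because ℝ is connected. -/
theorem continuous_log_sub_const {g g' : ℝ → ℂ} (hg : Continuous g) (hg' : Continuous g')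
    (h : ∀ t, Complex.exp (g t) = Complex.exp (g' t)) : g 1 - g 0 = g' 1 - g' 0 := by
  have hd : Continuous fun t => (g t - g' t - (g 0 - g' 0)) / (2 * Real.pi * Complex.I) := by
    fun_prop
  have hz : ∀ t, ∃ n : ℤ, (g t - g' t - (g 0 - g' 0)) / (2 * Real.pi * Complex.I) = n := by
    intro t
    obtain ⟨n, hn⟩ := Complex.exp_eq_exp_iff_exists_int.1 (h t)
    obtain ⟨m, hm⟩ := Complex.exp_eq_exp_iff_exists_int.1 (h 0)
    refine ⟨n - m, ?_⟩
    have : (2 * Real.pi * Complex.I : ℂ) ≠ 0 := Complex.two_pi_I_ne_zero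
    rw [div_eq_iff this, hn, hm]
    push_cast
    ring
  choose n hn using hz
  have hnc : Continuous n := by
    have : Continuous fun t => ((n t : ℤ) : ℂ) := by simpa only [hn] using hd
    exact (Complex.isClosedEmbedding_intCast.isInducing.continuous_iff).2 this
  have h10 : n 1 = n 0 := PreconnectedSpace.constant inferInstance hnc
  have e0 := hn 0
  have e1 := hn 1
  rw [h10, ← e0, sub_self, zero_div, div_eq_zero_iff] at e1
  rcases e1 with e1 | e1
  · linear_combination e1
  · exact absurd e1 Complex.two_pi_I_ne_zero

theorem logIncrement_eq {f g : ℝ → ℂ} (hg : Continuous g) (h : ∀ t, Complex.exp (g t) = f t) :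
    logIncrement f = g 1 - g 0 := by
  have hex : ∃ g : ℝ → ℂ, Continuous g ∧ ∀ t, Complex.exp (g t) = f t := ⟨g, hg, h⟩
  rw [logIncrement, dif_pos hex]
  exact continuous_log_sub_const hex.choose_spec.1 hg
    fun t => (hex.choose_spec.2 t).trans (h t).symm

theorem exp_logIncrement {f : ℝ → ℂ} (hf : Continuous f) (h0 : ∀ t, f t ≠ 0) :
    Complex.exp (logIncrement f) = f 1 / f 0 := by
  obtain ⟨g, hg, h⟩ := exists_continuous_log hf h0
  rw [logIncrement_eq hg h, Complex.exp_sub, h, h]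

/-- The minus sign only adds the constant πi to a logarithm; the reversal changes the sign of the
increment. -/
theorem logIncrement_neg_reverse {f : ℝ → ℂ} (hf : Continuous f) (h0 : ∀ t, f t ≠ 0) :
    logIncrement (fun t => - f (1 - t)) = - logIncrement f := by
  obtain ⟨g, hg, h⟩ := exists_continuous_log hf h0
  rw [logIncrement_eq hg h, logIncrement_eq (g := fun t => g (1 - t) + Real.pi * Complex.I)
    (by fun_prop) (fun t => by rw [Complex.exp_add, h, Complex.exp_pi_mul_I]; ring)]
  norm_num

/-- A nonvanishing function on the plane has a continuous logarithm `g` there, and both sides equal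
`g (1, 1) - g (0, 0)`. -/
theorem logIncrement_square {H : ℝ → ℝ → ℂ} (hH : Continuous fun x : ℝ × ℝ => H x.1 x.2)
    (h0 : ∀ s t, H s t ≠ 0) :
    logIncrement (fun s => H s 0) + logIncrement (H 1) =
      logIncrement (H 0) + logIncrement (fun s => H s 1) := by
  obtain ⟨g, hg, h⟩ := exists_continuous_log hH fun x => h0 x.1 x.2
  rw [logIncrement_eq (f := fun s => H s 0) (g := fun s => g (s, 0)) (by fun_prop) fun t => h _,
    logIncrement_eq (f := fun s => H s 1) (g := fun s => g (s, 1)) (by fun_prop) fun t => h _,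
    logIncrement_eq (f := H 0) (g := fun s => g (0, s)) (by fun_prop) fun t => h _,
    logIncrement_eq (f := H 1) (g := fun s => g (1, s)) (by fun_prop) fun t => h _]
  ring

/-! ### Perpendicular diameters of an embedded disc. -/

/-- The parametrization `t ↦ 1 - 2t` of `[-1, 1]`, extended by constants. -/
noncomputable def diameterParam (t : ℝ) : ℝ := max (-1) (min 1 (1 - 2 * t))

theorem continuous_diameterParam : Continuous diameterParam := by
  unfold diameterParam; fun_prop

@[simp] theorem diameterParam_zero : diameterParam 0 = 1 := by norm_num [diameterParam]

@[simp] theorem diameterParam_one : diameterParam 1 = -1 := by norm_num [diameterParam]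

theorem diameterParam_one_sub (t : ℝ) : diameterParam (1 - t) = - diameterParam t := by
  unfold diameterParam
  rcases le_total 1 (1 - 2 * t) with h | h <;> rcases le_total (-1) (1 - 2 * t) with h' | h' <;>
    rcases le_total 1 (1 - 2 * (1 - t)) with h2 | h2 <;>
    rcases le_total (-1) (1 - 2 * (1 - t)) with h2' | h2' <;>
    simp [*] <;> linarith

theorem abs_diameterParam_le (t : ℝ) : |diameterParam t| ≤ 1 :=
  abs_le.2 ⟨le_max_left _ _, max_le (by norm_num) (min_le_left _ _)⟩

/-- For `τ` from `0` to `1`, the difference of the values of `φ` at the ends of a segment that moves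
from the one between the points `x` and `y * I` of the perpendicular diameters of the unit disc to
a segment centred at `0`. -/
noncomputable def segmentDifference (φ : ℂ → ℂ) (s t τ : ℝ) : ℂ :=
  φ ((1 - max 0 (min 1 τ)) • (diameterParam s : ℂ) + max 0 (min 1 τ) •
      ((diameterParam s - diameterParam t * Complex.I) / 2)) -
    φ ((1 - max 0 (min 1 τ)) • (diameterParam t * Complex.I : ℂ) + max 0 (min 1 τ) •
      (-((diameterParam s - diameterParam t * Complex.I) / 2)))

theorem diameterParam_mem_closedBall (t : ℝ) :
    (diameterParam t : ℂ) ∈ Metric.closedBall (0 : ℂ) 1 := by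
  simpa using abs_diameterParam_le t

theorem diameterParam_mul_I_mem_closedBall (t : ℝ) :
    (diameterParam t * Complex.I : ℂ) ∈ Metric.closedBall (0 : ℂ) 1 := by
  simpa using abs_diameterParam_le t

theorem half_sub_mem_closedBall (s t : ℝ) :
    ((diameterParam s - diameterParam t * Complex.I) / 2 : ℂ) ∈ Metric.closedBall (0 : ℂ) 1 := by
  have h1 := diameterParam_mem_closedBall s
  have h2 := diameterParam_mul_I_mem_closedBall t
  rw [mem_closedBall_zero_iff] at *
  have := (norm_sub_le (diameterParam s : ℂ) (diameterParam t * Complex.I)).trans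
    (add_le_add h1 h2)
  rw [norm_div]
  norm_num at this ⊢
  linarith

theorem segment_fst_mem (s t τ : ℝ) :
    (1 - max 0 (min 1 τ)) • (diameterParam s : ℂ) + max 0 (min 1 τ) •
      ((diameterParam s - diameterParam t * Complex.I) / 2) ∈ Metric.closedBall (0 : ℂ) 1 :=
  convex_closedBall (0 : ℂ) 1 (diameterParam_mem_closedBall s) (half_sub_mem_closedBall s t)
    (sub_nonneg.2 (max_le zero_le_one (min_le_left _ _))) (le_max_left _ _) (by ring)

theorem segment_snd_mem (s t τ : ℝ) :
    (1 - max 0 (min 1 τ)) • (diameterParam t * Complex.I : ℂ) + max 0 (min 1 τ) •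
      (-((diameterParam s - diameterParam t * Complex.I) / 2)) ∈ Metric.closedBall (0 : ℂ) 1 :=
  convex_closedBall (0 : ℂ) 1 (diameterParam_mul_I_mem_closedBall t)
    (by simpa using half_sub_mem_closedBall s t)
    (sub_nonneg.2 (max_le zero_le_one (min_le_left _ _))) (le_max_left _ _) (by ring)

theorem continuous_segmentDifference {φ : ℂ → ℂ} (hc : ContinuousOn φ (Metric.closedBall 0 1)) :
    Continuous fun x : ℝ × ℝ × ℝ => segmentDifference φ x.1 x.2.1 x.2.2 := by
  have := continuous_diameterParam
  have h1 : Continuous fun x : ℝ × ℝ × ℝ => max 0 (min 1 x.2.2) := by fun_prop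
  have h2 : Continuous fun x : ℝ × ℝ × ℝ => (diameterParam x.1 : ℂ) := by fun_prop
  have h3 : Continuous fun x : ℝ × ℝ × ℝ => (diameterParam x.2.1 * Complex.I : ℂ) := by fun_prop
  have h4 := (h2.sub h3).div_const 2
  have h5 := continuous_const (y := (1 : ℝ)) |>.sub h1
  have h6 := (h5.smul h2).add (h1.smul h4)
  have h7 := (h5.smul h3).add (h1.smul h4.neg)
  have h8 := hc.comp_continuous h6 fun x => segment_fst_mem x.1 x.2.1 x.2.2
  have h9 := hc.comp_continuous h7 fun x => segment_snd_mem x.1 x.2.1 x.2.2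
  exact h8.sub h9

/-- The two arguments of `φ` differ by the same vector x - yi for every `τ`, so injectivity leaves
only x = y = 0, the centre of the square. -/
theorem segmentDifference_ne_zero {φ : ℂ → ℂ} (hi : Set.InjOn φ (Metric.closedBall 0 1))
    {s t : ℝ} (h : diameterParam s ≠ 0 ∨ diameterParam t ≠ 0) (τ : ℝ) :
    segmentDifference φ s t τ ≠ 0 := by
  intro h0
  have := hi (segment_fst_mem s t τ) (segment_snd_mem s t τ) (sub_eq_zero.1 h0)
  simp only [Complex.real_smul] at this
  have h2 : (diameterParam s - diameterParam t * Complex.I : ℂ) = 0 := by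
    push_cast at this
    linear_combination this
  have hre := congrArg Complex.re h2
  have him := congrArg Complex.im h2
  simp at hre him
  tauto

/-- At `τ = 1` the segment is centred at 0, so reflecting both parameters exchanges its ends. -/
theorem segmentDifference_neg (φ : ℂ → ℂ) {s t s' t' : ℝ}
    (hs : diameterParam s' = - diameterParam s) (ht : diameterParam t' = - diameterParam t) :
    segmentDifference φ s' t' 1 = - segmentDifference φ s t 1 := by
  simp only [segmentDifference, hs, ht]
  norm_num
  congr 2 <;> ring

/-- A map from the boundary of a square to the punctured plane that is homotopic to an odd map has
nonzero winding number. -/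
theorem logIncrement_square_boundary_ne {K : ℝ → ℝ → ℝ → ℂ}
    (hK : Continuous fun x : ℝ × ℝ × ℝ => K x.1 x.2.1 x.2.2)
    (b0 : ∀ s τ, K s 0 τ ≠ 0) (b1 : ∀ s τ, K s 1 τ ≠ 0)
    (l0 : ∀ t τ, K 0 t τ ≠ 0) (l1 : ∀ t τ, K 1 t τ ≠ 0)
    (hn : ∀ s t, K (1 - s) (1 - t) 1 = - K s t 1) :
    logIncrement (fun s => K s 0 0) + logIncrement (fun t => K 1 t 0) ≠
      logIncrement (fun t => K 0 t 0) + logIncrement (fun s => K s 1 0) := by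
  intro h
  have r1 := logIncrement_square (H := fun s τ => K s 0 τ)
    (hK.comp (by fun_prop : Continuous fun x : ℝ × ℝ => (x.1, (0 : ℝ), x.2))) b0
  have r2 := logIncrement_square (H := fun s τ => K s 1 τ)
    (hK.comp (by fun_prop : Continuous fun x : ℝ × ℝ => (x.1, (1 : ℝ), x.2))) b1
  have r3 := logIncrement_square (H := fun s τ => K 0 s τ)
    (hK.comp (by fun_prop : Continuous fun x : ℝ × ℝ => ((0 : ℝ), x.1, x.2))) l0
  have r4 := logIncrement_square (H := fun s τ => K 1 s τ)
    (hK.comp (by fun_prop : Continuous fun x : ℝ × ℝ => ((1 : ℝ), x.1, x.2))) l1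
  have cb : Continuous fun s => K s 0 1 :=
    hK.comp (by fun_prop : Continuous fun s : ℝ => (s, (0 : ℝ), (1 : ℝ)))
  have cl : Continuous fun t => K 0 t 1 :=
    hK.comp (by fun_prop : Continuous fun t : ℝ => ((0 : ℝ), t, (1 : ℝ)))
  have t1 := logIncrement_neg_reverse cb fun s => b0 s 1
  have t2 := logIncrement_neg_reverse cl fun s => l0 s 1
  have e1 : (fun s => - K (1 - s) 0 1) = fun s => K s 1 1 := by
    funext s
    simpa [neg_eq_iff_eq_neg] using hn s 1
  have e2 : (fun t => - K 0 (1 - t) 1) = fun t => K 1 t 1 := by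
    funext t
    simpa [neg_eq_iff_eq_neg] using hn 1 t
  rw [e1] at t1
  rw [e2] at t2
  -- By oddness the increments on opposite sides are negatives of each other, so a vanishing total
  -- is twice the difference of two adjacent sides. Exponentiating then equates the values at two
  -- opposite corners, which oddness makes negatives of each other.
  have key : logIncrement (fun s => K s 0 1) = logIncrement (fun t => K 0 t 1) := by
    linear_combination (1 / 2 : ℂ) * (h - r1 + r2 + r3 - r4 + t1 - t2)
  have := congrArg Complex.exp key
  rw [exp_logIncrement cb fun s => b0 s 1, exp_logIncrement cl fun s => l0 s 1,
    div_left_inj' (b0 0 1)] at this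
  have h10 := hn 0 1
  simp only [sub_zero, sub_self] at h10
  exact b1 0 1 (self_eq_neg.1 (this.symm.trans h10))

/-- Two paths in the plane that join the ends of two perpendicular diameters of an embedded closed
disc, and that avoid the rest of the disc, meet. -/
theorem exists_eq_of_paths_outside_disc {φ : ℂ → ℂ}
    (hc : ContinuousOn φ (Metric.closedBall 0 1)) (hi : Set.InjOn φ (Metric.closedBall 0 1))
    (P : Path (φ 1) (φ (-1))) (Q : Path (φ Complex.I) (φ (-Complex.I)))
    (hP : ∀ s, ∀ z ∈ Metric.closedBall (0 : ℂ) 1, φ z = P s → z = 1 ∨ z = -1)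
    (hQ : ∀ s, ∀ z ∈ Metric.closedBall (0 : ℂ) 1, φ z = Q s → z = Complex.I ∨ z = -Complex.I) :
    ∃ s t, P s = Q t := by
  by_contra! hPQ
  have hd := continuous_diameterParam
  have cU : Continuous fun s => φ (diameterParam s) :=
    hc.comp_continuous (by fun_prop) diameterParam_mem_closedBall
  have cV : Continuous fun s => φ (diameterParam s * Complex.I) :=
    hc.comp_continuous (by fun_prop) diameterParam_mul_I_mem_closedBall
  have cP := P.continuous_extend
  have cQ := Q.continuous_extend
  -- Let U, V be the images of the diameters. P - Q, P - V and U - Q vanish nowhere on the square.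
  -- As U has the ends of P and V those of Q, the combination `r2 + r3 - r1` says that U - V has
  -- total increment 0 around the boundary.
  have r1 := logIncrement_square (H := fun s t => P.extend s - Q.extend t) (by fun_prop)
    fun s t => sub_ne_zero.2 (hPQ _ _)
  have r2 := logIncrement_square (H := fun s t => P.extend s - φ (diameterParam t * Complex.I))
    ((cP.comp continuous_fst).sub (cV.comp continuous_snd)) fun s t h => by
      rcases hP _ _ (diameterParam_mul_I_mem_closedBall t) (sub_eq_zero.1 h).symm with h | h <;>
        simpa using congrArg Complex.re h
  have r3 := logIncrement_square (H := fun s t => φ (diameterParam s) - Q.extend t)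
    ((cU.comp continuous_fst).sub (cQ.comp continuous_snd)) fun s t h => by
      rcases hQ _ _ (diameterParam_mem_closedBall s) (sub_eq_zero.1 h) with h | h <;>
        simpa using congrArg Complex.im h
  apply logIncrement_square_boundary_ne (continuous_segmentDifference hc)
    (fun s => segmentDifference_ne_zero hi (by simp))
    (fun s => segmentDifference_ne_zero hi (by simp))
    (fun s => segmentDifference_ne_zero hi (by simp))
    (fun s => segmentDifference_ne_zero hi (by simp))
    (fun s t => segmentDifference_neg φ (diameterParam_one_sub s) (diameterParam_one_sub t))
  simp only [Path.extend_zero, Path.extend_one, diameterParam_zero, diameterParam_one,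
    Complex.ofReal_neg, Complex.ofReal_one, one_mul, neg_mul] at r1 r2 r3
  simp [segmentDifference]
  linear_combination r2 + r3 - r1

/-! ### Connected subgraphs of a drawing as point sets. -/

namespace PlaneDrawing

variable {V : Type*} {G : SimpleGraph V}

/-- The part of a drawing that represents the connected component of `v` in a subgraph `H`. -/
def componentSupport (D : PlaneDrawing G) (H : SimpleGraph V) (v : V) : Set ℂ :=
  {x | ∃ u, H.Reachable v u ∧ (x = D.pos u ∨ ∃ u', H.Adj u u' ∧ x ∈ D.arc s(u, u'))}

variable {D : PlaneDrawing G} {H : SimpleGraph V}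

theorem componentSupport_subset_support (hH : H ≤ G) (v : V) :
    D.componentSupport H v ⊆ D.support := by
  rintro x ⟨u, -, rfl | ⟨u', ha, hx⟩⟩
  · exact Or.inl ⟨u, rfl⟩
  · exact Or.inr (Set.mem_biUnion (x := s(u, u')) (hH ha) hx)

theorem joinedIn_componentSupport (hH : H ≤ G) {v u : V} (h : H.Reachable v u) :
    JoinedIn (D.componentSupport H v) (D.pos v) (D.pos u) := by
  obtain ⟨W⟩ := h
  suffices ∀ u u' : V, H.Reachable v u → H.Walk u u' →
      JoinedIn (D.componentSupport H v) (D.pos u) (D.pos u') from this v u (.refl v) W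
  intro u u' hu W
  induction W with
  | nil => exact JoinedIn.refl ⟨_, hu, Or.inl rfl⟩
  | cons ha _ ih =>
    obtain ⟨γ, -, hγ⟩ := D.arc_isArc _ _ (hH ha)
    refine JoinedIn.trans ⟨γ, fun t => ⟨_, hu, Or.inr ⟨_, ha, hγ ▸ ⟨t, rfl⟩⟩⟩⟩
      (ih (hu.trans ha.reachable))

theorem reachable_of_pos_mem_componentSupport (hH : H ≤ G) {v t : V}
    (h : D.pos t ∈ D.componentSupport H v) : H.Reachable v t := by
  obtain ⟨u, hu, h | ⟨u', ha, hx⟩⟩ := h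
  · rwa [D.pos_injective h]
  · rcases Sym2.mem_iff.1 (D.mem_of_pos_mem_arc _ (hH ha) t hx) with rfl | rfl
    · exact hu
    · exact hu.trans ha.reachable

/-- Arcs of different edges meet only in vertices, and a vertex on an arc is an end of its edge; so
a common point yields a common vertex or a common edge. -/
theorem reachable_of_mem_componentSupport (hH : H ≤ G) {v v' : V} {x : ℂ}
    (h : x ∈ D.componentSupport H v) (h' : x ∈ D.componentSupport H v') : H.Reachable v v' := by
  have key : ∀ t, x = D.pos t → H.Reachable v v' := by
    rintro t rfl
    exact (reachable_of_pos_mem_componentSupport hH h).trans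
      (reachable_of_pos_mem_componentSupport hH h').symm
  obtain ⟨u, hu, h | ⟨w, ha, hx⟩⟩ := h
  · exact key u h
  obtain ⟨u', hu', h' | ⟨w', ha', hx'⟩⟩ := h'
  · exact key u' h'
  by_cases he : s(u, w) = s(u', w')
  · have : u' ∈ s(u, w) := he ▸ Sym2.mem_mk_left u' w'
    rcases Sym2.mem_iff.1 this with rfl | rfl
    · exact hu.trans hu'.symm
    · exact (hu.trans ha.reachable).trans hu'.symm
  · obtain ⟨t, rfl⟩ := D.arc_inter_arc _ (hH ha) _ (hH ha') he ⟨hx, hx'⟩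
    exact key t rfl

/-- Two connected subgraphs of a plane graph that join opposite pairs of four vertices met in
cyclic order on a face are not disjoint. -/
theorem reachable_of_cyclicOrderOnFace {F : Set ℂ} {p q r s : V}
    (hcyc : D.CyclicOrderOnFace F p q r s) (hH : H ≤ G)
    (hpr : H.Reachable p r) (hqs : H.Reachable q s) : H.Reachable p q := by
  by_contra hpq
  obtain ⟨⟨z, -, rfl⟩, φ, hc, hi, h1, hI, hm1, hmI, hF⟩ := hcyc
  obtain ⟨P, hP⟩ := joinedIn_componentSupport (D := D) hH hpr
  obtain ⟨Q, hQ⟩ := joinedIn_componentSupport (D := D) hH hqs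
  -- The disc lies in the face, hence off the drawing, except at its four marked points.
  have key : ∀ v x, x ∈ D.componentSupport H v → ∀ z ∈ Metric.closedBall (0 : ℂ) 1, φ z = x →
      z ∈ ({1, Complex.I, -1, -Complex.I} : Set ℂ) := by
    rintro v x hx z hz rfl
    by_contra hz'
    exact connectedComponentIn_subset _ _ (hF z hz hz')
      (componentSupport_subset_support hH v hx)
  obtain ⟨t, t', htt⟩ := exists_eq_of_paths_outside_disc hc hi (P.cast h1 hm1) (Q.cast hI hmI)
    (by
      intro t z hz h
      rcases key p _ (hP t) z hz h with rfl | rfl | rfl | rfl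
      · exact Or.inl rfl
      · refine absurd (reachable_of_pos_mem_componentSupport (D := D) hH ?_) hpq
        rw [← hI, h]; exact hP t
      · exact Or.inr rfl
      · refine absurd ((reachable_of_pos_mem_componentSupport (D := D) hH ?_).trans hqs.symm) hpq
        rw [← hmI, h]; exact hP t)
    (by
      intro t z hz h
      rcases key q _ (hQ t) z hz h with rfl | rfl | rfl | rfl
      · refine absurd (reachable_of_pos_mem_componentSupport (D := D) hH ?_).symm hpq
        rw [← h1, h]; exact hQ t
      · exact Or.inl rfl
      · refine absurd (hpr.trans (reachable_of_pos_mem_componentSupport (D := D) hH ?_).symm) hpq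
        rw [← hm1, h]; exact hQ t
      · exact Or.inr rfl)
  refine hpq (reachable_of_mem_componentSupport (D := D) hH (hP t) ?_)
  have : P t = Q t' := htt
  rw [this]
  exact hQ t'

end PlaneDrawing

/-! ### Superposition of two matchings and condensation. -/

section MatchingsAsEdgeSets

open scoped Classical

variable {V R : Type*} [CommRing R]

/-- `A` is the edge set of a perfect matching of the graph `G - S`. -/
def IsMatchingOff (G : SimpleGraph V) (S : Set V) (A : Finset (Sym2 V)) : Prop :=
  (∀ e ∈ A, e ∈ G.edgeSet) ∧ ∀ v, (A.filter (v ∈ ·)).card = if v ∈ S then 0 else 1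

/-- The edge sets of the perfect matchings of `G - S`. -/
noncomputable def matchingsOff [Fintype V] (G : SimpleGraph V) (S : Set V) : Finset (Finset (Sym2 V)) :=
  Finset.univ.filter (IsMatchingOff G S)

/-- The weighted count of the perfect matchings of `G - S`. -/
noncomputable def matchingSumOff [Fintype V] (G : SimpleGraph V) (w : Sym2 V → R) (S : Set V) : R :=
  ∑ A ∈ matchingsOff G S, ∏ e ∈ A, w e

@[simp] theorem mem_matchingsOff [Fintype V] {G : SimpleGraph V} {S : Set V} {A : Finset (Sym2 V)} :
    A ∈ matchingsOff G S ↔ IsMatchingOff G S A := by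
  simp [matchingsOff]

theorem IsMatchingOff.unique_set {G : SimpleGraph V} {S S' : Set V} {A : Finset (Sym2 V)}
    (h : IsMatchingOff G S A) (h' : IsMatchingOff G S' A) : S = S' := by
  ext v
  have := (h.2 v).symm.trans (h'.2 v)
  by_cases h1 : v ∈ S <;> by_cases h2 : v ∈ S' <;> simp_all

theorem IsMatchingOff.notMem {G : SimpleGraph V} {S : Set V} {A : Finset (Sym2 V)}
    (h : IsMatchingOff G S A) {v : V} (hv : v ∈ S) {e : Sym2 V} (he : e ∈ A) : v ∉ e := by
  have := h.2 v
  rw [if_pos hv, Finset.card_eq_zero, Finset.filter_eq_empty_iff] at this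
  exact this he

/-- Double counting of the incidences between vertices and a set of edges. -/
theorem sum_mul_card_incident [Fintype V] {G : SimpleGraph V} {A : Finset (Sym2 V)}
    (hA : ∀ e ∈ A, e ∈ G.edgeSet) (f : V → ℤ) (g : Sym2 V → ℤ)
    (hg : ∀ a b, s(a, b) ∈ A → f a + f b = g s(a, b)) :
    ∑ v, f v * (A.filter (v ∈ ·)).card = ∑ e ∈ A, g e := by
  have h1 : ∀ v, f v * ((A.filter (v ∈ ·)).card : ℤ) = ∑ e ∈ A, if v ∈ e then f v else 0 := by
    intro v
    rw [← Finset.sum_filter, Finset.sum_const, nsmul_eq_mul, mul_comm]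
  simp_rw [h1]
  rw [Finset.sum_comm]
  refine Finset.sum_congr rfl fun e he => ?_
  induction e using Sym2.ind with
  | _ a b =>
    have hab : a ≠ b := G.ne_of_adj (hA _ he)
    rw [← hg a b he, ← Finset.sum_filter, ← Finset.sum_pair hab]
    congr 1
    ext v
    simp

/-- The vertices that are connected with `p` by edges in `A ∪ B`. -/
def unionComponent (A B : Finset (Sym2 V)) (p : V) : Set V :=
  {v | (SimpleGraph.fromEdgeSet {e | e ∈ A ∨ e ∈ B}).Reachable p v}

theorem mem_unionComponent_self (A B : Finset (Sym2 V)) (p : V) : p ∈ unionComponent A B p :=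
  SimpleGraph.Reachable.refl p

theorem unionComponent_closed {A B : Finset (Sym2 V)} {p u v : V} {e : Sym2 V}
    (he : e ∈ A ∪ B) (hu : u ∈ e) (hv : v ∈ e) (hK : u ∈ unionComponent A B p) :
    v ∈ unionComponent A B p := by
  by_cases h : u = v
  · exact h ▸ hK
  · have : e = s(u, v) := (Sym2.mem_and_mem_iff h).1 ⟨hu, hv⟩
    refine SimpleGraph.Reachable.trans hK (SimpleGraph.Adj.reachable ?_)
    rw [SimpleGraph.fromEdgeSet_adj]
    refine ⟨?_, h⟩
    rw [← this]
    simpa using he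

/-- The edge `e` has an end in `K`. -/
def Meets (K : Set V) (e : Sym2 V) : Prop := ∃ v ∈ K, v ∈ e

theorem meets_mk {K : Set V} {a b : V} : Meets K s(a, b) ↔ a ∈ K ∨ b ∈ K := by
  simp only [Meets, Sym2.mem_iff]
  constructor
  · rintro ⟨v, hv, rfl | rfl⟩
    exacts [Or.inl hv, Or.inr hv]
  · rintro (h | h)
    exacts [⟨a, h, Or.inl rfl⟩, ⟨b, h, Or.inr rfl⟩]

/-- The number of edges of `A` that meet a closed set of vertices. -/
theorem two_mul_card_filter_meets [Fintype V] {G : SimpleGraph V} {S K : Set V} {A : Finset (Sym2 V)}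
    (hA : IsMatchingOff G S A)
    (hK : ∀ e ∈ A, ∀ u ∈ e, ∀ v ∈ e, u ∈ K → v ∈ K) :
    2 * ((A.filter fun e => Meets K e).card : ℤ) =
      ∑ v, if v ∈ K ∧ v ∉ S then 1 else 0 := by
  -- Since `K` is closed along `A`, an edge of `A` has both ends in `K` or none.
  have := sum_mul_card_incident hA.1 (fun v => if v ∈ K then 1 else 0)
    (fun e => if Meets K e then 2 else 0) (by
      intro a b hab
      have h1 := hK _ hab a (by simp) b (by simp)
      have h2 := hK _ hab b (by simp) a (by simp)
      by_cases ha : a ∈ K <;> by_cases hb : b ∈ K <;> simp_all [meets_mk])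
  rw [← Finset.sum_filter, Finset.sum_const, nsmul_eq_mul, mul_comm] at this
  rw [← this]
  refine Finset.sum_congr rfl fun v _ => ?_
  rw [hA.2 v]
  by_cases h1 : v ∈ K <;> by_cases h2 : v ∈ S <;> simp [h1, h2]

/-- A connected graph on n vertices has at least n - 1 edges. Edges common to `A` and `B` are
counted twice, which only weakens the bound. -/
theorem card_unionComponent_le [Fintype V] {A B : Finset (Sym2 V)} (p : V) :
    Nat.card (unionComponent A B p) ≤
      (A.filter fun e => Meets (unionComponent A B p) e).card +
      (B.filter fun e => Meets (unionComponent A B p) e).card + 1 := by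
  set H := SimpleGraph.fromEdgeSet {e | e ∈ A ∨ e ∈ B} with hH
  set K := unionComponent A B p with hK
  have hKs : (H.connectedComponentMk p).supp = K := by
    ext v
    simp only [SimpleGraph.ConnectedComponent.mem_supp_iff, SimpleGraph.ConnectedComponent.eq]
    exact ⟨fun h => h.symm, fun h => SimpleGraph.Reachable.symm h⟩
  have hc : (H.induce K).Connected := by
    rw [← hKs]
    exact SimpleGraph.ConnectedComponent.connected_toSimpleGraph _
  refine hc.card_vert_le_card_edgeSet_add_one.trans (Nat.add_le_add_right ?_ 1)
  refine le_trans ?_ (Finset.card_union_le _ _)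
  rw [← Nat.card_eq_finsetCard]
  refine Nat.card_le_card_of_injective (fun e => ⟨e.1.map Subtype.val, ?_⟩) ?_
  · obtain ⟨e, he⟩ := e
    induction e using Sym2.ind with
    | _ a b =>
      have hab : H.Adj a.1 b.1 := he
      rw [hH, SimpleGraph.fromEdgeSet_adj] at hab
      simp only [Sym2.map_mk, Finset.mem_union, Finset.mem_filter, meets_mk]
      exact hab.1.imp (fun h => ⟨h, Or.inl a.2⟩) fun h => ⟨h, Or.inl a.2⟩
  · intro e e' h
    exact Subtype.ext (Sym2.map.injective Subtype.val_injective (congrArg Subtype.val h))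

/-- Let a, b be the numbers of edges of `A`, `B` meeting the component `K`, and k = |K ∩ T|.
Counting covered vertices gives 2a + 2b + k = 2|K|, so k is even; connectedness gives |K| ≤ a + b +
1, so k ≤ 2. The shape of the component as a path or cycle is not needed. -/
theorem card_ends_unionComponent [Fintype V] {G : SimpleGraph V} {S S' T : Set V} {A B : Finset (Sym2 V)}
    (hA : IsMatchingOff G S A) (hB : IsMatchingOff G S' B)
    (hT : ∀ v, v ∈ T ↔ ¬ (v ∈ S ↔ v ∈ S')) (hd : Disjoint S S') (v₀ : V) :
    (∑ v, if v ∈ unionComponent A B v₀ ∧ v ∈ T then (1 : ℤ) else 0) = 0 ∨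
    (∑ v, if v ∈ unionComponent A B v₀ ∧ v ∈ T then (1 : ℤ) else 0) = 2 := by
  have hle := card_unionComponent_le (A := A) (B := B) v₀
  set K := unionComponent A B v₀ with hK
  have h1 := two_mul_card_filter_meets (K := K) hA fun e he u hu v hv =>
    unionComponent_closed (Finset.mem_union_left _ he) hu hv
  have h2 := two_mul_card_filter_meets (K := K) hB fun e he u hu v hv =>
    unionComponent_closed (Finset.mem_union_right _ he) hu hv
  have h3 : (∑ v, if v ∈ K ∧ v ∉ S then (1 : ℤ) else 0) +
      (∑ v, if v ∈ K ∧ v ∉ S' then (1 : ℤ) else 0) +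
      (∑ v, if v ∈ K ∧ v ∈ T then (1 : ℤ) else 0) = 2 * Nat.card K := by
    have : (Nat.card K : ℤ) = ∑ v, if v ∈ K then (1 : ℤ) else 0 := by
      rw [Finset.sum_boole, Nat.card_eq_fintype_card, Fintype.card_subtype]
    rw [this, ← Finset.sum_add_distrib, ← Finset.sum_add_distrib, Finset.mul_sum]
    refine Finset.sum_congr rfl fun v _ => ?_
    have := hT v
    have h' : v ∈ S → v ∉ S' := fun h => Set.disjoint_left.1 hd h
    by_cases k : v ∈ K <;> by_cases k1 : v ∈ S <;> by_cases k2 : v ∈ S' <;> simp_all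
  have h4 : 0 ≤ ∑ v, if v ∈ K ∧ v ∈ T then (1 : ℤ) else 0 :=
    Finset.sum_nonneg fun v _ => by split_ifs <;> norm_num
  omega

/-- `A` outside `K` and `B` inside `K`. -/
noncomputable def toggle (K : Set V) (A B : Finset (Sym2 V)) : Finset (Sym2 V) :=
  A.filter (fun e => ¬ Meets K e) ∪ B.filter (fun e => Meets K e)

theorem mem_toggle {K : Set V} {A B : Finset (Sym2 V)} {e : Sym2 V} :
    e ∈ toggle K A B ↔ (e ∈ A ∧ ¬ Meets K e) ∨ (e ∈ B ∧ Meets K e) := by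
  simp only [toggle, Finset.mem_union, Finset.mem_filter]

theorem toggle_toggle (K : Set V) (A B : Finset (Sym2 V)) :
    toggle K (toggle K A B) (toggle K B A) = A := by
  ext e
  simp only [mem_toggle]
  by_cases Meets K e <;> tauto

/-- Toggling redistributes edges between the two sets but keeps their union. The component along
which to exchange is therefore the same afterwards, which makes the exchange an involution. -/
theorem unionComponent_toggle (K : Set V) (A B : Finset (Sym2 V)) (p : V) :
    unionComponent (toggle K A B) (toggle K B A) p = unionComponent A B p := by
  have : {e | e ∈ toggle K A B ∨ e ∈ toggle K B A} = {e | e ∈ A ∨ e ∈ B} := by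
    ext e
    simp only [Set.mem_ofPred_eq, mem_toggle]
    by_cases Meets K e <;> tauto
  simp only [unionComponent, this]

theorem prod_toggle_mul_prod_toggle (K : Set V) (A B : Finset (Sym2 V)) (w : Sym2 V → R) :
    (∏ e ∈ toggle K A B, w e) * ∏ e ∈ toggle K B A, w e = (∏ e ∈ A, w e) * ∏ e ∈ B, w e := by
  have hd : ∀ A B : Finset (Sym2 V), Disjoint (A.filter (fun e => ¬ Meets K e))
      (B.filter (fun e => Meets K e)) := fun A B =>
    Finset.disjoint_left.2 fun e h h' => (Finset.mem_filter.1 h).2 (Finset.mem_filter.1 h').2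
  rw [toggle, toggle, Finset.prod_union (hd _ _), Finset.prod_union (hd _ _),
    ← Finset.prod_filter_mul_prod_filter_not A (fun e => Meets K e),
    ← Finset.prod_filter_mul_prod_filter_not B (fun e => Meets K e)]
  ring

/-- Because `K` is closed, the toggled set agrees with `B` at every vertex of `K` and with `A` at
every other vertex. -/
theorem IsMatchingOff.toggle {G : SimpleGraph V} {S S' K : Set V} {A B : Finset (Sym2 V)}
    (hA : IsMatchingOff G S A) (hB : IsMatchingOff G S' B)
    (hK : ∀ e ∈ A ∪ B, ∀ u ∈ e, ∀ v ∈ e, u ∈ K → v ∈ K) :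
    IsMatchingOff G ((S \ K) ∪ (S' ∩ K)) (toggle K A B) := by
  refine ⟨fun e he => ?_, fun v => ?_⟩
  · rcases mem_toggle.1 he with h | h
    exacts [hA.1 e h.1, hB.1 e h.1]
  · by_cases hv : v ∈ K
    · have : (_root_.toggle K A B).filter (v ∈ ·) = B.filter (v ∈ ·) := by
        ext e
        simp only [Finset.mem_filter, mem_toggle]
        have : v ∈ e → Meets K e := fun h => ⟨v, hv, h⟩
        by_cases Meets K e <;> tauto
      rw [this, hB.2 v]
      simp [hv]
    · have : (_root_.toggle K A B).filter (v ∈ ·) = A.filter (v ∈ ·) := by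
        ext e
        simp only [Finset.mem_filter, mem_toggle]
        have : e ∈ A ∪ B → v ∈ e → ¬ Meets K e := fun h h1 ⟨u, hu, hue⟩ =>
          hv (hK e h u hue v h1 hu)
        rw [Finset.mem_union] at this
        by_cases Meets K e <;> tauto
      rw [this, hA.2 v]
      simp [hv]

/-- In the superposition of two matchings that together miss each of `p, q, r, s` once, where no two
disjoint paths join `p` to `r` and `q` to `s`, the path from `p` leads to `q` or to `s`. -/
theorem unionComponent_ends [Fintype V] {G : SimpleGraph V} {S S' : Set V} {p q r s : V}
    (hpq : p ≠ q) (hpr : p ≠ r) (hps : p ≠ s) (hqr : q ≠ r) (hqs : q ≠ s) (hrs : r ≠ s)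
    (hX : ∀ H ≤ G, H.Reachable p r → H.Reachable q s → H.Reachable p q)
    {A B : Finset (Sym2 V)} (hA : IsMatchingOff G S A) (hB : IsMatchingOff G S' B)
    (hT : ∀ v, v ∈ ({p, q, r, s} : Set V) ↔ ¬ (v ∈ S ↔ v ∈ S')) (hd : Disjoint S S') :
    r ∉ unionComponent A B p ∧ (q ∈ unionComponent A B p ↔ s ∉ unionComponent A B p) := by
  obtain ⟨T, hT'⟩ : ∃ T : Set V, T = {p, q, r, s} := ⟨_, rfl⟩
  rw [← hT'] at hT
  have hsum : ∀ K : Set V, (∑ v, if v ∈ K ∧ v ∈ T then (1 : ℤ) else 0) =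
      (if p ∈ K then 1 else 0) + (if q ∈ K then 1 else 0) + (if r ∈ K then 1 else 0) +
        (if s ∈ K then 1 else 0) := by
    intro K
    have : ∀ v, (if v ∈ K ∧ v ∈ T then (1 : ℤ) else 0) =
        if v ∈ ({p, q, r, s} : Finset V) then (if v ∈ K then 1 else 0) else 0 := by
      intro v
      simp only [hT', Set.mem_insert_iff, Set.mem_singleton_iff, Finset.mem_insert,
        Finset.mem_singleton]
      by_cases h : v ∈ K <;> simp [h]
    simp_rw [this]
    rw [Finset.sum_ite_mem, Finset.univ_inter, Finset.sum_insert (by simp [*]),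
      Finset.sum_insert (by simp [*]), Finset.sum_insert (by simp [*]), Finset.sum_singleton]
    ring
  have hp := card_ends_unionComponent hA hB hT hd p
  have hq := card_ends_unionComponent hA hB hT hd q
  rw [hsum, if_pos (mem_unionComponent_self A B p)] at hp
  rw [hsum, if_pos (mem_unionComponent_self A B q)] at hq
  set H := SimpleGraph.fromEdgeSet {e | e ∈ A ∨ e ∈ B} with hH
  have hHG : H ≤ G := by
    intro u v h
    rw [hH, SimpleGraph.fromEdgeSet_adj] at h
    exact h.1.elim (fun h => hA.1 _ h) fun h => hB.1 _ h
  have e1 : ∀ u v, v ∈ unionComponent A B u ↔ H.Reachable u v := fun _ _ => Iff.rfl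
  simp only [e1] at hp hq ⊢
  -- If `r` were the second end in the component of `p`, then `q` would lie in another component,
  -- whose second end could only be `s`. This contradicts `hX`.
  have hr : ¬ H.Reachable p r := by
    intro hr
    have hq' : ¬ H.Reachable p q := by
      intro hq'
      rw [if_pos hr, if_pos hq'] at hp
      split_ifs at hp <;> omega
    have hqp : ¬ H.Reachable q p := fun h => hq' h.symm
    have hqr : ¬ H.Reachable q r := fun h => hq' (hr.trans h.symm)
    rw [if_neg hqp, if_neg hqr] at hq
    have hqs : H.Reachable q s := by
      by_contra h
      rw [if_neg h] at hq
      omega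
    exact hq' (hX H hHG hr hqs)
  refine ⟨hr, ?_⟩
  rw [if_neg hr] at hp
  by_cases h1 : H.Reachable p q <;> by_cases h2 : H.Reachable p s <;> simp [h1, h2] at hp ⊢

theorem sum_union_product {α : Type*} [DecidableEq α] {f : α → R} {s₁ t₁ s₂ t₂ : Finset α}
    (h : Disjoint s₁ s₂) :
    ∑ x ∈ s₁ ×ˢ t₁ ∪ s₂ ×ˢ t₂, f x.1 * f x.2 =
      (∑ x ∈ s₁, f x) * (∑ x ∈ t₁, f x) + (∑ x ∈ s₂, f x) * ∑ x ∈ t₂, f x := by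
  rw [Finset.sum_union, Finset.sum_mul_sum, Finset.sum_mul_sum, Finset.sum_product,
    Finset.sum_product]
  exact Finset.disjoint_product.2 (Or.inl h)

theorem disjoint_matchingsOff [Fintype V] {G : SimpleGraph V} {S S' : Set V} (h : S ≠ S') :
    Disjoint (matchingsOff G S) (matchingsOff G S') :=
  Finset.disjoint_left.2 fun _ h1 h2 =>
    h ((mem_matchingsOff.1 h1).unique_set (mem_matchingsOff.1 h2))

/-- The four-term identity of graphical condensation. -/
theorem matchingSumOff_condensation [Fintype V] (G : SimpleGraph V) (w : Sym2 V → R) {p q r s : V}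
    (hpq : p ≠ q) (hpr : p ≠ r) (hps : p ≠ s) (hqr : q ≠ r) (hqs : q ≠ s) (hrs : r ≠ s)
    (hX : ∀ H ≤ G, H.Reachable p r → H.Reachable q s → H.Reachable p q) :
    matchingSumOff G w ∅ * matchingSumOff G w {p, q, r, s} +
        matchingSumOff G w {q, s} * matchingSumOff G w {p, r} =
      matchingSumOff G w {p, q} * matchingSumOff G w {r, s} +
        matchingSumOff G w {p, s} * matchingSumOff G w {q, r} := by
  -- The first matching of a pair tells the two products on each side apart, so each side becomes a
  -- single sum over pairs of matchings.
  have d1 : (∅ : Set V) ≠ {q, s} := (Set.insert_nonempty q {s}).ne_empty.symm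
  have d2 : ({p, q} : Set V) ≠ {p, s} := by
    intro h
    have : q ∈ ({p, s} : Set V) := h ▸ (by simp : q ∈ ({p, q} : Set V))
    simp only [Set.mem_insert_iff, Set.mem_singleton_iff] at this
    tauto
  unfold matchingSumOff
  rw [← sum_union_product (disjoint_matchingsOff d1), ← sum_union_product (disjoint_matchingsOff d2)]
  let swap : Finset (Sym2 V) × Finset (Sym2 V) → Finset (Sym2 V) × Finset (Sym2 V) := fun x =>
    (toggle (unionComponent x.1 x.2 p) x.1 x.2, toggle (unionComponent x.1 x.2 p) x.2 x.1)
  have swap_swap : ∀ x, swap (swap x) = x := by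
    rintro ⟨A, B⟩
    simp only [swap, unionComponent_toggle, toggle_toggle]
  have swap_off : ∀ {S S' A B}, IsMatchingOff G S A → IsMatchingOff G S' B →
      IsMatchingOff G ((S \ unionComponent A B p) ∪ (S' ∩ unionComponent A B p))
        (swap (A, B)).1 ∧
      IsMatchingOff G ((S' \ unionComponent A B p) ∪ (S ∩ unionComponent A B p))
        (swap (A, B)).2 := fun {_ _ A B} hA hB =>
    ⟨hA.toggle hB fun e he u hu v hv => unionComponent_closed he hu hv,
      hB.toggle hA fun e he u hu v hv => unionComponent_closed (Finset.union_comm B A ▸ he) hu hv⟩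
  have case_of : ∀ {S S' S₁ S₁' S₂ S₂' : Set V} {A B},
      IsMatchingOff G S A → IsMatchingOff G S' B →
      (∀ v, v ∈ ({p, q, r, s} : Set V) ↔ ¬ (v ∈ S ↔ v ∈ S')) → Disjoint S S' →
      (∀ K : Set V, p ∈ K → r ∉ K → q ∈ K → s ∉ K →
        (S \ K) ∪ (S' ∩ K) = S₁ ∧ (S' \ K) ∪ (S ∩ K) = S₁') →
      (∀ K : Set V, p ∈ K → r ∉ K → q ∉ K → s ∈ K →
        (S \ K) ∪ (S' ∩ K) = S₂ ∧ (S' \ K) ∪ (S ∩ K) = S₂') →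
      (IsMatchingOff G S₁ (swap (A, B)).1 ∧ IsMatchingOff G S₁' (swap (A, B)).2) ∨
        (IsMatchingOff G S₂ (swap (A, B)).1 ∧ IsMatchingOff G S₂' (swap (A, B)).2) := by
    intro S S' S₁ S₁' S₂ S₂' A B hA hB hT hd h1 h2
    obtain ⟨hr, hqs'⟩ := unionComponent_ends hpq hpr hps hqr hqs hrs hX hA hB hT hd
    have hp := mem_unionComponent_self A B p
    obtain ⟨m1, m2⟩ := swap_off hA hB
    by_cases hq : q ∈ unionComponent A B p
    · obtain ⟨k1, k2⟩ := h1 _ hp hr hq (hqs'.1 hq)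
      exact Or.inl ⟨k1 ▸ m1, k2 ▸ m2⟩
    · obtain ⟨k1, k2⟩ := h2 _ hp hr hq (by tauto)
      exact Or.inr ⟨k1 ▸ m1, k2 ▸ m2⟩
  refine Finset.sum_nbij' swap swap ?_ ?_ (fun x _ => swap_swap x) (fun x _ => swap_swap x)
    fun x _ => (prod_toggle_mul_prod_toggle _ _ _ w).symm
  · rintro ⟨A, B⟩ h
    simp only [Finset.mem_union, Finset.mem_product, mem_matchingsOff] at h ⊢
    rcases h with ⟨hA, hB⟩ | ⟨hA, hB⟩
    · refine case_of hA hB (fun v => ?_) (Set.disjoint_left.2 fun v => ?_)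
        (fun K _ _ _ _ => ⟨Set.ext fun v => ?_, Set.ext fun v => ?_⟩)
        (fun K _ _ _ _ => ⟨Set.ext fun v => ?_, Set.ext fun v => ?_⟩) <;>
      · simp only [Set.mem_insert_iff, Set.mem_singleton_iff, Set.mem_union, Set.mem_sdiff,
          Set.mem_inter_iff, Set.mem_empty_iff_false]
        clear case_of swap_off swap_swap hX hA hB d1 d2 swap
        grind
    -- From `{q, s}` and `{p, r}`, a component with `p` and `q` leads to the second product on the
    -- right and one with `p` and `s` to the first, whence the symmetry.
    · refine (case_of hA hB (fun v => ?_) (Set.disjoint_left.2 fun v => ?_)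
        (fun K _ _ _ _ => ⟨Set.ext fun v => ?_, Set.ext fun v => ?_⟩)
        (fun K _ _ _ _ => ⟨Set.ext fun v => ?_, Set.ext fun v => ?_⟩)).symm <;>
      · simp only [Set.mem_insert_iff, Set.mem_singleton_iff, Set.mem_union, Set.mem_sdiff,
          Set.mem_inter_iff]
        clear case_of swap_off swap_swap hX hA hB d1 d2 swap
        grind
  · rintro ⟨A, B⟩ h
    simp only [Finset.mem_union, Finset.mem_product, mem_matchingsOff] at h ⊢
    rcases h with ⟨hA, hB⟩ | ⟨hA, hB⟩
    · refine case_of hA hB (fun v => ?_) (Set.disjoint_left.2 fun v => ?_)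
        (fun K _ _ _ _ => ⟨Set.ext fun v => ?_, Set.ext fun v => ?_⟩)
        (fun K _ _ _ _ => ⟨Set.ext fun v => ?_, Set.ext fun v => ?_⟩) <;>
      · simp only [Set.mem_insert_iff, Set.mem_singleton_iff, Set.mem_union, Set.mem_sdiff,
          Set.mem_inter_iff, Set.mem_empty_iff_false]
        clear case_of swap_off swap_swap hX hA hB d1 d2 swap
        grind
    · refine (case_of hA hB (fun v => ?_) (Set.disjoint_left.2 fun v => ?_)
        (fun K _ _ _ _ => ⟨Set.ext fun v => ?_, Set.ext fun v => ?_⟩)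
        (fun K _ _ _ _ => ⟨Set.ext fun v => ?_, Set.ext fun v => ?_⟩)).symm <;>
      · simp only [Set.mem_insert_iff, Set.mem_singleton_iff, Set.mem_union, Set.mem_sdiff,
          Set.mem_inter_iff]
        clear case_of swap_off swap_swap hX hA hB d1 d2 swap
        grind

end MatchingsAsEdgeSets

/-! ### Matching sums as sums over edge sets; edge deletion and colour balance. -/

section MatchingSums

open scoped Classical

variable {V R : Type*} [CommRing R]

theorem IsMatchingOff.existsUnique {G : SimpleGraph V} {S : Set V} {A : Finset (Sym2 V)}
    (h : IsMatchingOff G S A) {v : V} (hv : v ∉ S) : ∃! u, s(v, u) ∈ A := by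
  have := h.2 v
  rw [if_neg hv, Finset.card_eq_one] at this
  obtain ⟨e, he⟩ := this
  have hmem : ∀ e', e' ∈ A ∧ v ∈ e' ↔ e' = e := fun e' => by
    rw [← Finset.mem_singleton, ← he, Finset.mem_filter]
  obtain ⟨u, rfl⟩ := ((hmem e).2 rfl).2
  refine ⟨u, ((hmem _).2 rfl).1, fun u' hu' => ?_⟩
  exact Sym2.congr_right.1 ((hmem s(v, u')).1 ⟨hu', Sym2.mem_mk_left _ _⟩)

theorem card_filter_mem_eq_one {A : Finset (Sym2 V)} {v : V} (h : ∃! u, s(v, u) ∈ A) :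
    (A.filter (v ∈ ·)).card = 1 := by
  obtain ⟨u, hu, huu⟩ := h
  rw [Finset.card_eq_one]
  refine ⟨s(v, u), ?_⟩
  ext e
  simp only [Finset.mem_filter, Finset.mem_singleton]
  constructor
  · rintro ⟨he, u', rfl⟩
    rw [huu u' he]
  · rintro rfl
    exact ⟨hu, Sym2.mem_mk_left _ _⟩

/-- The matching sum of an induced subgraph, in terms of edge sets of the whole graph. -/
theorem matchingSum_eq_matchingSumOff [Fintype V] {V' : Type*} [Finite V'] (H' : SimpleGraph V')
    (H : SimpleGraph V) (f : V' → V) (hf : Function.Injective f)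
    (hH : ∀ u v, H'.Adj u v ↔ H.Adj (f u) (f v)) (w : Sym2 V → R) :
    matchingSum H' (fun e => w (e.map f)) = matchingSumOff H w (Set.range f)ᶜ := by
  have hinj := Sym2.map.injective hf
  have hmem : ∀ (P : H'.Subgraph) (a b : V'),
      s(f a, f b) ∈ (Set.toFinite P.edgeSet).toFinset.image (Sym2.map f) ↔ P.Adj a b := by
    intro P a b
    rw [← Sym2.map_mk, hinj.mem_finset_image, Set.Finite.mem_toFinset,
      SimpleGraph.Subgraph.mem_edgeSet]
  have hmem' : ∀ (P : H'.Subgraph) (a : V') (x : V),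
      s(f a, x) ∈ (Set.toFinite P.edgeSet).toFinset.image (Sym2.map f) ↔
        ∃ b, f b = x ∧ P.Adj a b := by
    intro P a x
    constructor
    · intro h
      obtain ⟨e, -, he⟩ := Finset.mem_image.1 h
      have : x ∈ e.map f := he ▸ Sym2.mem_mk_right _ _
      obtain ⟨b, -, rfl⟩ := Sym2.mem_map.1 this
      exact ⟨b, rfl, (hmem P a b).1 h⟩
    · rintro ⟨b, rfl, h⟩
      exact (hmem P a b).2 h
  unfold matchingSum matchingSumOff
  refine Finset.sum_bij (fun P _ => (Set.toFinite P.edgeSet).toFinset.image (Sym2.map f))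
    ?_ ?_ ?_ ?_
  · intro P hP
    rw [Set.Finite.mem_toFinset, Set.mem_ofPred_eq,
      SimpleGraph.Subgraph.isPerfectMatching_iff] at hP
    rw [mem_matchingsOff]
    refine ⟨fun e he => ?_, fun v => ?_⟩
    · obtain ⟨e, he', rfl⟩ := Finset.mem_image.1 he
      rw [Set.Finite.mem_toFinset] at he'
      induction e using Sym2.ind with
      | _ a b => exact (hH a b).1 (P.adj_sub he')
    · split_ifs with hv
      · rw [Finset.card_eq_zero, Finset.filter_eq_empty_iff]
        intro e he hve
        obtain ⟨e, -, rfl⟩ := Finset.mem_image.1 he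
        obtain ⟨b, -, rfl⟩ := Sym2.mem_map.1 hve
        exact hv ⟨b, rfl⟩
      · obtain ⟨a, rfl⟩ := not_not.1 hv
        obtain ⟨b, hb, hbu⟩ := hP a
        refine card_filter_mem_eq_one ⟨f b, (hmem P a b).2 hb, fun x hx => ?_⟩
        obtain ⟨b', rfl, hb'⟩ := (hmem' P a x).1 hx
        rw [hbu b' hb']
  · intro P hP Q hQ h
    rw [Set.Finite.mem_toFinset] at hP hQ
    ext1
    · rw [hP.2.verts_eq_univ, hQ.2.verts_eq_univ]
    · ext a b
      rw [← hmem P, ← hmem Q, h]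
  · intro A hA
    rw [mem_matchingsOff] at hA
    have hadj : ∀ {a b}, s(f a, f b) ∈ A → H'.Adj a b := fun h => (hH _ _).2 (hA.1 _ h)
    -- The inverse map: no edge of `A` leaves the range of `f`, so `A` pulls back to a spanning
    -- subgraph.
    let P : H'.Subgraph :=
      { verts := Set.univ
        Adj := fun a b => s(f a, f b) ∈ A
        adj_sub := hadj
        edge_vert := fun _ => Set.mem_univ _
        symm := ⟨fun a b h => by rwa [Sym2.eq_swap]⟩ }
    have hrange : ∀ {e x}, e ∈ A → x ∈ e → x ∈ Set.range f := by
      intro e x he hx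
      by_contra hn
      exact hA.notMem hn he hx
    refine ⟨P, ?_, ?_⟩
    · rw [Set.Finite.mem_toFinset, Set.mem_ofPred_eq, SimpleGraph.Subgraph.isPerfectMatching_iff]
      intro a
      obtain ⟨u, hu, huu⟩ := hA.existsUnique (v := f a) (by simp)
      obtain ⟨b, rfl⟩ := hrange hu (Sym2.mem_mk_right _ _)
      exact ⟨b, hu, fun b' hb' => hf (huu _ hb')⟩
    · ext e
      constructor
      · intro he
        obtain ⟨e, he', rfl⟩ := Finset.mem_image.1 he
        rw [Set.Finite.mem_toFinset] at he'
        induction e using Sym2.ind with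
        | _ a b => exact he'
      · intro he
        induction e using Sym2.ind with
        | _ x y =>
          obtain ⟨a, rfl⟩ := hrange he (Sym2.mem_mk_left _ _)
          obtain ⟨b, rfl⟩ := hrange he (Sym2.mem_mk_right _ _)
          exact (hmem P a b).2 he
  · intro P hP
    rw [Finset.prod_image hinj.injOn]

theorem matchingSum_eq_matchingSumOff_empty [Fintype V] (G : SimpleGraph V) (w : Sym2 V → R) :
    matchingSum G w = matchingSumOff G w ∅ := by
  have := matchingSum_eq_matchingSumOff G G id Function.injective_id (fun _ _ => Iff.rfl) w
  simpa using this

theorem matchingSumDelete_eq_matchingSumOff [Fintype V] (G : SimpleGraph V) (w : Sym2 V → R) (S : Set V) :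
    matchingSumDelete G w S = matchingSumOff G w S := by
  have := matchingSum_eq_matchingSumOff (G.induce Sᶜ) G Subtype.val Subtype.val_injective
    (fun _ _ => Iff.rfl) w
  rw [matchingSumDelete, this, Subtype.range_val, compl_compl]

theorem isMatchingOff_deleteEdges {G : SimpleGraph V} {S : Set V} {e : Sym2 V}
    {A : Finset (Sym2 V)} :
    IsMatchingOff (G.deleteEdges {e}) S A ↔ IsMatchingOff G S A ∧ e ∉ A := by
  simp only [IsMatchingOff, SimpleGraph.edgeSet_deleteEdges, Set.mem_sdiff,
    Set.mem_singleton_iff]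
  constructor
  · rintro ⟨h1, h2⟩
    exact ⟨⟨fun e he => (h1 e he).1, h2⟩, fun he => (h1 e he).2 rfl⟩
  · rintro ⟨⟨h1, h2⟩, h3⟩
    exact ⟨fun e' he => ⟨h1 e' he, fun h => h3 (h ▸ he)⟩, h2⟩

/-- Deleting an edge that meets a deleted vertex does not change the matching sum. -/
theorem matchingSumOff_deleteEdges [Fintype V] (G : SimpleGraph V) (w : Sym2 V → R) {S : Set V} {e : Sym2 V}
    {v : V} (hv : v ∈ S) (hve : v ∈ e) :
    matchingSumOff (G.deleteEdges {e}) w S = matchingSumOff G w S := by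
  unfold matchingSumOff
  congr 1
  ext A
  rw [mem_matchingsOff, mem_matchingsOff, isMatchingOff_deleteEdges]
  exact ⟨fun h => h.1, fun h => ⟨h, fun he => h.notMem hv he hve⟩⟩

/-- The matchings are split according to whether they contain the edge `ab`. -/
theorem matchingSumOff_eq_add [Fintype V] (G : SimpleGraph V) (w : Sym2 V → R) {S : Set V} {a b : V}
    (hab : G.Adj a b) (ha : a ∉ S) (hb : b ∉ S) :
    matchingSumOff G w S = matchingSumOff (G.deleteEdges {s(a, b)}) w S +
      w s(a, b) * matchingSumOff G w (S ∪ {a, b}) := by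
  unfold matchingSumOff
  rw [← Finset.sum_filter_add_sum_filter_not (matchingsOff G S) (fun A => s(a, b) ∉ A)]
  congr 1
  · refine Finset.sum_congr ?_ fun _ _ => rfl
    ext A
    rw [Finset.mem_filter, mem_matchingsOff, mem_matchingsOff, isMatchingOff_deleteEdges]
  · rw [Finset.mul_sum]
    have hins : ∀ (A : Finset (Sym2 V)) (v : V), s(a, b) ∉ A →
        ((insert s(a, b) A).filter (v ∈ ·)).card =
          (if v = a ∨ v = b then 1 else 0) + (A.filter (v ∈ ·)).card := by
      intro A v hA
      rw [Finset.filter_insert]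
      by_cases h : v ∈ s(a, b)
      · rw [if_pos h, if_pos (Sym2.mem_iff.1 h),
          Finset.card_insert_of_notMem fun h' => hA (Finset.mem_filter.1 h').1, add_comm]
      · rw [if_neg h, if_neg fun h' => h (Sym2.mem_iff.2 h'), zero_add]
    have hS : ∀ v, v ∈ S ∪ {a, b} ↔ v ∈ S ∨ (v = a ∨ v = b) := fun v => Iff.rfl
    refine Finset.sum_nbij' (fun A => A.erase s(a, b)) (fun A => insert s(a, b) A) ?_ ?_ ?_ ?_ ?_
    · intro A hA
      rw [Finset.mem_filter, not_not, mem_matchingsOff] at hA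
      obtain ⟨⟨h1, h2⟩, h3⟩ := hA
      rw [mem_matchingsOff]
      refine ⟨fun e he => h1 e (Finset.mem_of_mem_erase he), fun v => ?_⟩
      have := h2 v
      rw [← Finset.insert_erase h3, hins _ _ (Finset.notMem_erase _ _)] at this
      by_cases h4 : v = a ∨ v = b
      · have h5 : v ∉ S := by rcases h4 with rfl | rfl <;> assumption
        rw [if_pos h4, if_neg h5] at this
        rw [if_pos ((hS v).2 (Or.inr h4))]
        omega
      · rw [if_neg h4, zero_add] at this
        rw [this]
        simp only [hS, h4, or_false]
    · intro A hA
      rw [mem_matchingsOff] at hA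
      have h3 : s(a, b) ∉ A := fun h =>
        hA.notMem ((hS a).2 (Or.inr (Or.inl rfl))) h (Sym2.mem_mk_left _ _)
      rw [Finset.mem_filter, not_not, mem_matchingsOff]
      refine ⟨⟨fun e he => ?_, fun v => ?_⟩, Finset.mem_insert_self _ _⟩
      · rcases Finset.mem_insert.1 he with rfl | he
        exacts [hab, hA.1 e he]
      · rw [hins _ _ h3, hA.2 v]
        by_cases h4 : v = a ∨ v = b
        · have h5 : v ∉ S := by rcases h4 with rfl | rfl <;> assumption
          rw [if_pos h4, if_neg h5, if_pos ((hS v).2 (Or.inr h4))]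
        · rw [if_neg h4, zero_add]
          simp only [hS, h4, or_false]
    · intro A hA
      rw [Finset.mem_filter, not_not] at hA
      exact Finset.insert_erase hA.2
    · intro A hA
      rw [mem_matchingsOff] at hA
      exact Finset.erase_insert fun h =>
        hA.notMem ((hS a).2 (Or.inr (Or.inl rfl))) h (Sym2.mem_mk_left _ _)
    · intro A hA
      rw [Finset.mem_filter, not_not] at hA
      exact (Finset.mul_prod_erase A w hA.2).symm

/-- Signed counting of the vertices by colour. -/
theorem IsMatchingOff.sum_color [Fintype V] {G : SimpleGraph V} {S : Set V} {A : Finset (Sym2 V)}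
    (h : IsMatchingOff G S A) (C : G.Coloring (Fin 2)) :
    ∑ v, (if C v = 0 then (1 : ℤ) else -1) =
      ∑ v, if v ∈ S then (if C v = 0 then (1 : ℤ) else -1) else 0 := by
  -- The ends of an edge have opposite signs, so each edge contributes 0.
  have := sum_mul_card_incident h.1 (fun v => if C v = 0 then (1 : ℤ) else -1) (fun _ => 0) (by
    intro a b hab
    have hne := C.valid (h.1 _ hab : G.Adj a b)
    have : C a = 0 ∨ C a = 1 := by omega
    have : C b = 0 ∨ C b = 1 := by omega
    by_cases h1 : C a = 0 <;> by_cases h2 : C b = 0 <;> simp_all)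
  rw [Finset.sum_const_zero] at this
  rw [← sub_eq_zero, ← Finset.sum_sub_distrib, ← this]
  refine Finset.sum_congr rfl fun v _ => ?_
  rw [h.2 v]
  by_cases v ∈ S <;> simp only [*, if_true, if_false] <;> ring

/-- Two vertices of one colour and two vertices of the other colour cannot both be the vertices
missed by a matching. -/
theorem matchingSumOff_mul_eq_zero [Fintype V] {G : SimpleGraph V} (C : G.Coloring (Fin 2)) (w : Sym2 V → R)
    {x x' y y' : V} (hx : x ≠ x') (hy : y ≠ y') (hxx : C x = C x') (hyy : C y = C y')
    (hxy : C x ≠ C y) :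
    matchingSumOff G w {x, x'} * matchingSumOff G w {y, y'} = 0 := by
  have hs : ∀ {z z' : V} {S : Set V}, S = {z, z'} → z ≠ z' →
      (∑ v, if v ∈ S then (if C v = 0 then (1 : ℤ) else -1) else 0) =
        (if C z = 0 then (1 : ℤ) else -1) + (if C z' = 0 then (1 : ℤ) else -1) := by
    intro z z' S hS h
    rw [← Finset.sum_pair (f := fun v => if C v = 0 then (1 : ℤ) else -1) h,
      ← Finset.univ_inter {z, z'}, ← Finset.sum_ite_mem]
    exact Finset.sum_congr rfl fun v _ => if_congr (by simp [hS]) rfl rfl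
  unfold matchingSumOff
  rw [Finset.sum_mul_sum]
  refine Finset.sum_eq_zero fun A hA => Finset.sum_eq_zero fun B hB => ?_
  -- Both missed pairs would have the same signed count as all of `V`, but one counts 2 and the
  -- other -2.
  have := ((mem_matchingsOff.1 hA).sum_color C).symm.trans ((mem_matchingsOff.1 hB).sum_color C)
  rw [hs rfl hx, hs rfl hy, ← hxx, ← hyy] at this
  have h1 : C x = 0 ∨ C x = 1 := by omega
  have h2 : C y = 0 ∨ C y = 1 := by omega
  rcases h1 with h1 | h1 <;> rcases h2 with h2 | h2 <;>
    first
    | exact absurd (h1.trans h2.symm) hxy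
    | (rw [h1, h2] at this; norm_num at this)

end MatchingSums

/-! ### The two identities. -/

theorem corollary3p5 {V R : Type*} [Finite V] [CommRing R]
    (G : SimpleGraph V) (D : PlaneDrawing G) (C : G.Coloring (Fin 2)) (w : Sym2 V → R)
    (a₁ b₁ a₂ b₂ : V) (h₁ : G.Adj a₁ b₁) (h₂ : G.Adj a₂ b₂)
    (ha : a₁ ≠ a₂) (hab : a₁ ≠ b₂) (hba : b₁ ≠ a₂) (hb : b₁ ≠ b₂)
    (F : Set ℂ) (hF : D.IsFace F)
    (he₁ : D.EdgeOnBoundary F s(a₁, b₁)) (he₂ : D.EdgeOnBoundary F s(a₂, b₂))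
    (F' : Set ℂ) (hcyc : D.CyclicOrderOnFace F' a₁ b₁ a₂ b₂) :
    (C a₁ = C a₂ →
      matchingSum G w * matchingSum (G.deleteEdges {s(a₁, b₁), s(a₂, b₂)}) w =
        matchingSum (G.deleteEdges {s(a₁, b₁)}) w * matchingSum (G.deleteEdges {s(a₂, b₂)}) w +
        w s(a₁, b₁) * w s(a₂, b₂) *
          (matchingSumDelete G w {a₁, b₂} * matchingSumDelete G w {a₂, b₁})) ∧
    (C a₁ ≠ C a₂ →
      matchingSum G w * matchingSum (G.deleteEdges {s(a₁, b₁), s(a₂, b₂)}) w =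
        matchingSum (G.deleteEdges {s(a₁, b₁)}) w * matchingSum (G.deleteEdges {s(a₂, b₂)}) w -
        w s(a₁, b₁) * w s(a₂, b₂) *
          (matchingSumDelete G w {a₁, a₂} * matchingSumDelete G w {b₁, b₂})) := by
  have := Fintype.ofFinite V
  set e₁ := s(a₁, b₁) with he₁'
  set e₂ := s(a₂, b₂) with he₂'
  have hdel : G.deleteEdges {e₁, e₂} = (G.deleteEdges {e₁}).deleteEdges {e₂} := by
    rw [SimpleGraph.deleteEdges_deleteEdges]; rfl
  have hdel' : G.deleteEdges {e₁, e₂} = (G.deleteEdges {e₂}).deleteEdges {e₁} := by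
    rw [SimpleGraph.deleteEdges_deleteEdges, Set.pair_comm]; rfl
  have hne : e₁ ≠ e₂ := by
    intro h
    have : a₁ ∈ e₂ := h ▸ Sym2.mem_mk_left a₁ b₁
    rcases Sym2.mem_iff.1 this with h | h
    exacts [ha h, hab h]
  set G' := G.deleteEdges {e₁, e₂} with hG'
  simp only [matchingSum_eq_matchingSumOff_empty, matchingSumDelete_eq_matchingSumOff]
  -- An edge with a deleted end lies in no matching, so once both edges have lost an end, `G` may be
  -- replaced by `G'`.
  have off : ∀ {S : Set V} {u v : V}, u ∈ S → v ∈ S → u ∈ e₁ → v ∈ e₂ →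
      matchingSumOff G w S = matchingSumOff G' w S := by
    intro S u v hu hv hu' hv'
    rw [hdel, matchingSumOff_deleteEdges _ w hv hv', matchingSumOff_deleteEdges _ w hu hu']
  have m1 : a₁ ∈ e₁ := Sym2.mem_mk_left _ _
  have m1' : b₁ ∈ e₁ := Sym2.mem_mk_right _ _
  have m2 : a₂ ∈ e₂ := Sym2.mem_mk_left _ _
  have m2' : b₂ ∈ e₂ := Sym2.mem_mk_right _ _
  have s1 := matchingSumOff_eq_add G w (S := ∅) h₁ (by simp) (by simp)
  have s2 := matchingSumOff_eq_add (G.deleteEdges {e₁}) w (S := ∅) (a := a₂) (b := b₂)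
    (by rw [SimpleGraph.deleteEdges_adj]; exact ⟨h₂, hne.symm⟩) (by simp) (by simp)
  have s3 := matchingSumOff_eq_add (G.deleteEdges {e₂}) w (S := ∅) (a := a₁) (b := b₁)
    (by rw [SimpleGraph.deleteEdges_adj]; exact ⟨h₁, hne⟩) (by simp) (by simp)
  have s4 := matchingSumOff_eq_add G w (S := {a₁, b₁}) h₂ (by simp [ha.symm, hba.symm])
    (by simp [hab.symm, hb.symm])
  have hT : ({a₁, b₁} ∪ {a₂, b₂} : Set V) = {a₁, b₁, a₂, b₂} := by
    rw [Set.insert_union, Set.singleton_union]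
  rw [Set.empty_union] at s1 s2 s3
  rw [← he₁'] at s1 s3
  rw [← he₂'] at s2 s4
  rw [← hdel] at s2
  rw [← hdel', ← matchingSumOff_deleteEdges _ w (by simp : a₁ ∈ ({a₁, b₁} : Set V)) m1,
    ← hdel'] at s3
  have t1 : matchingSumOff (G.deleteEdges {e₂}) w {a₁, b₁} = matchingSumOff G' w {a₁, b₁} := by
    rw [hdel', matchingSumOff_deleteEdges _ w (by simp : a₁ ∈ ({a₁, b₁} : Set V)) m1]
  rw [t1, hT, off (S := {a₁, b₁, a₂, b₂}) (u := a₁) (v := a₂) (by simp) (by simp) m1 m2] at s4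
  rw [← matchingSumOff_deleteEdges _ w (by simp : a₂ ∈ ({a₂, b₂} : Set V)) m2, ← hdel] at s2
  rw [off (S := {a₁, b₂}) (u := a₁) (v := b₂) (by simp) (by simp) m1 m2',
    off (S := {a₂, b₁}) (u := b₁) (v := a₂) (by simp) (by simp) m1' m2,
    off (S := {a₁, a₂}) (u := a₁) (v := a₂) (by simp) (by simp) m1 m2,
    off (S := {b₁, b₂}) (u := b₁) (v := b₂) (by simp) (by simp) m1' m2']
  have key := matchingSumOff_condensation G' w h₁.ne ha hab hba hb h₂.ne fun H hH =>
    PlaneDrawing.reachable_of_cyclicOrderOnFace hcyc (hH.trans (G.deleteEdges_le _))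
  have cv : ∀ {u v}, G.Adj u v → C u ≠ C v := fun h => C.valid h
  let C' : G'.Coloring (Fin 2) := SimpleGraph.Coloring.mk C fun h => C.valid (G.deleteEdges_le _ h)
  have c1 := cv h₁
  have c2 := cv h₂
  constructor
  · intro hc
    -- `a₁, a₂` have one colour and `b₁, b₂` the other, so the extra product on the left of `key`
    -- vanishes.
    have z := matchingSumOff_mul_eq_zero C' w ha hb hc (show C b₁ = C b₂ by omega) c1
    rw [Set.pair_comm a₂ b₁]
    rw [s1, s4, s3, s2]
    linear_combination w e₁ * w e₂ * key - w e₁ * w e₂ * z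
  · intro hc
    -- With only two colours, `a₁, b₂` share one and `b₁, a₂` the other, so now the last product of
    -- `key` vanishes.
    have z := matchingSumOff_mul_eq_zero C' w hab hba (show C a₁ = C b₂ by omega)
      (show C b₁ = C a₂ by omega) c1
    rw [s1, s4, s3, s2]
    linear_combination w e₁ * w e₂ * key + w e₁ * w e₂ * z
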